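/- Let $\mathbb D$ be the open unit disc. For $z,w\in\mathbb D$ put $\rho(z,w)=\left|\frac{z-w}{1-z\overline w}\right|$, and for $\zeta\in\partial\mathbb D$ put $P_z(\zeta)=\frac{1-|z|^2}{|\zeta-z|^2}$. A finite or infinite (possibly empty) sequence $(z_n)$ in $\mathbb D$ is called a Blaschke sequence if $\sum_n(1-|z_n|)<\infty$, and it is called separated if $\inf_{m\ne n}\rho(z_m,z_n)>0$. Let $\Lambda=(\lambda_n)_{n\in\mathbb N}$ be a separated sequence in $\mathbb D$ that is not a Blaschke sequence, and let $(\varepsilon_\lambda)_{\lambda\in\Lambda}$ be positive real numbers. Then there exists a bounded holomorphic function $f$ on $\mathbb D$, not identically zero, with $|f(\lambda)|<\varepsilon_\lambda$ for all $\lambda\in\Lambda$, if and only if $\Lambda$ is the union of a Blaschke sequence and a sequence $\Gamma$ (both subsequences of $\Lambda$) for which there exists a constant $C=C(\Gamma)>0$ such that $$\sum_{\gamma\in\Gamma}c_\gamma\log\varepsilon_\gamma^{-1}\le C\sup_{\zeta\in\partial\mathbb D}\sum_{\gamma\in\Gamma}c_\gamma P_\gamma(\zeta)$$ for every family $(c_\gamma)_{\gamma\in\Gamma}$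 of nonnegative real numbers. Here both sides are taken in $[-\infty,\infty]$; the sum on the left, whose terms may be negative, is the sum of the positive parts minus the sum of the negative parts, with the convention $\infty-\infty=-\infty$. -/

import Mathlib

open scoped NNReal ENNReal

noncomputable section

/-- The pseudo-hyperbolic distance `ρ(z, w) = |(z - w) / (1 - z * conj w)|` in the unit disc. -/
def pseudoHyperbolicDist (z w : ℂ) : ℝ :=
  ‖(z - w) / (1 - z * (starRingEnd ℂ) w)‖

/-- A family of points of the disc is separated if `inf_{i ≠ j} ρ(z i, z j) > 0`. -/
def IsSeparatedSeq {ι : Type*} (z : ι → ℂ) : Prop :=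
  ∃ δ : ℝ, 0 < δ ∧ ∀ i j, i ≠ j → δ ≤ pseudoHyperbolicDist (z i) (z j)

/-- The Blaschke condition `∑ (1 - |z i|) < ∞` (all terms are positive for points of the disc).
Finite and empty families satisfy it. -/
def IsBlaschkeSeq {ι : Type*} (z : ι → ℂ) : Prop :=
  Summable fun i => 1 - ‖z i‖

/-- `f` belongs to `H^∞`: it is holomorphic and bounded in the open unit disc. -/
def MemHInfty (f : ℂ → ℂ) : Prop :=
  DifferentiableOn ℂ f (Metric.ball 0 1) ∧
    ∃ M : ℝ, ∀ z ∈ Metric.ball (0 : ℂ) 1, ‖f z‖ ≤ M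

/-- The sum of a family of real numbers as an extended real number: the sum of the positive
parts minus the sum of the negative parts, with the convention `∞ - ∞ = -∞` of `EReal`. -/
def extendedSum {ι : Type*} (a : ι → ℝ) : EReal :=
  ((∑' i, ENNReal.ofReal (a i) : ℝ≥0∞) : EReal) -
    ((∑' i, ENNReal.ofReal (-a i) : ℝ≥0∞) : EReal)

/-- `sup_{|ζ| = 1} ∑ c i * P_{z i}(ζ)`, in `[0, ∞]`. For `|ζ| = 1` Mathlib's
`poissonKernel 0 w ζ` is `(1 - |w|²) / |ζ - w|²`. -/
def supBalayage {ι : Type*} (z : ι → ℂ) (c : ι → ℝ≥0) : ℝ≥0∞ :=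
  ⨆ ζ ∈ Metric.sphere (0 : ℂ) 1, ∑' i, ENNReal.ofReal (c i * poissonKernel 0 (z i) ζ)

/-- There is a constant `C` such that
`∑ c i * log (1 / ε i) ≤ C * sup_{|ζ| = 1} ∑ c i * P_{z i}(ζ)` for all nonnegative `c`. -/
def BalayageCondition {ι : Type*} (z : ι → ℂ) (ε : ι → ℝ) : Prop :=
  ∃ C : ℝ, 0 < C ∧ ∀ c : ι → ℝ≥0,
    extendedSum (fun i => c i * Real.log (ε i)⁻¹) ≤ (C : EReal) * (supBalayage z c : EReal)

end

/-!
For necessity, normalize `f` to be bounded by `1`, with `f w ≠ 0`. The points of `Λ` that are close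
to some zero of `f` are assigned to the Blaschke part: by separation each zero is close to at most
one of them, and the zeros satisfy the Blaschke condition by Jensen's inequality
(`isBlaschkeSeq_of_close_to_zeros`). The other points stay at a fixed pseudo-hyperbolic distance
from all zeros, and there `log (1 / |f|)` behaves like a positive harmonic function as far as sums
`∑ c i * log (1 / |f (γ i)|)` are concerned (`sum_neg_log_norm_le`). Indeed, `f` is a finite product
of Blaschke factors times a function without zeros in a disc of radius `R` close to `1`. Away from
its zero `a`, the Blaschke factor contributes at most a constant times `(1 - |a| ^ 2) P_z(ζ)`, where
`ζ` is the radial projection of `a` (`exists_one_sub_pseudoHyperbolicDist_sq_le`), and the zero-free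
part is handled by the Poisson formula on the circle of radius `R`
(`sum_neg_log_norm_le_of_ne_zero`). Both contributions are at most a constant times the supremum of
`∑ c i * P_{γ i}` times the corresponding part of `log (1 / |f w|)`. Working with an arbitrary base
point `w`, instead of the origin, avoids a separate treatment of a zero at the origin.

For sufficiency, the balayage inequality is dual to the existence of positive harmonic majorants of
`log (1 / ε)`: by the Hahn-Banach theorem, for every finite set of points there is a holomorphic `h`
with nonnegative real part and `Re h(0) = C` such that `Re h ≥ log (1 / ε) - 1` at these points
(`exists_mem_posRealPart_le`). Multiplying `exp (-1 - h)` by a finite Blaschke product for the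
Blaschke part gives functions that are bounded by `1`, and bounded below at the origin, uniformly in
the finite set (`exists_norm_le_on_finset`). A limit of these functions, which exists by Montel's
theorem (`exists_differentiableOn_tendsto`), is the required function up to the factor `z / 2`. The
Poisson integral representation of positive harmonic functions and infinite Blaschke products are
not needed.
-/

/-! ### The pseudo-hyperbolic distance -/

/-- The identity behind all estimates for the pseudo-hyperbolic distance. -/
lemma norm_one_sub_mul_conj_sq (z w : ℂ) :
    ‖1 - z * (starRingEnd ℂ) w‖ ^ 2 = ‖z - w‖ ^ 2 + (1 - ‖z‖ ^ 2) * (1 - ‖w‖ ^ 2) := by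
  simp only [← Complex.normSq_eq_norm_sq, Complex.normSq_apply, Complex.sub_re, Complex.sub_im,
    Complex.mul_re, Complex.mul_im, Complex.conj_re, Complex.conj_im, Complex.one_re,
    Complex.one_im]
  ring

lemma one_sub_norm_le_norm_one_sub_mul_conj {z w : ℂ} (hz : ‖z‖ < 1) :
    1 - ‖w‖ ≤ ‖1 - z * (starRingEnd ℂ) w‖ := by
  have h := norm_sub_norm_le (1 : ℂ) (z * (starRingEnd ℂ) w)
  rw [norm_one, norm_mul, RCLike.norm_conj] at h
  nlinarith [norm_nonneg w, norm_nonneg z]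

lemma one_sub_mul_conj_ne_zero {z w : ℂ} (hz : ‖z‖ < 1) (hw : ‖w‖ < 1) :
    1 - z * (starRingEnd ℂ) w ≠ 0 := by
  have := one_sub_norm_le_norm_one_sub_mul_conj (w := w) hz
  exact norm_pos_iff.1 (by linarith)

lemma norm_one_sub_mul_conj_le_two {z w : ℂ} (hz : ‖z‖ < 1) (hw : ‖w‖ < 1) :
    ‖1 - z * (starRingEnd ℂ) w‖ ≤ 2 := by
  have h := norm_sub_le (1 : ℂ) (z * (starRingEnd ℂ) w)
  rw [norm_one, norm_mul, RCLike.norm_conj] at h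
  nlinarith [norm_nonneg w, norm_nonneg z]

lemma pseudoHyperbolicDist_nonneg (z w : ℂ) : 0 ≤ pseudoHyperbolicDist z w := norm_nonneg _

lemma pseudoHyperbolicDist_self (z : ℂ) : pseudoHyperbolicDist z z = 0 := by
  simp [pseudoHyperbolicDist]

lemma one_sub_pseudoHyperbolicDist_sq {z w : ℂ} (hz : ‖z‖ < 1) (hw : ‖w‖ < 1) :
    1 - pseudoHyperbolicDist z w ^ 2 =
      (1 - ‖z‖ ^ 2) * (1 - ‖w‖ ^ 2) / ‖1 - z * (starRingEnd ℂ) w‖ ^ 2 := by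
  have h0 : ‖1 - z * (starRingEnd ℂ) w‖ ≠ 0 := norm_ne_zero_iff.2 (one_sub_mul_conj_ne_zero hz hw)
  have h := norm_one_sub_mul_conj_sq z w
  rw [pseudoHyperbolicDist, norm_div, div_pow]
  field_simp
  linarith

lemma one_sub_norm_sq_pos {z : ℂ} (hz : ‖z‖ < 1) : 0 < 1 - ‖z‖ ^ 2 := by
  nlinarith [norm_nonneg z]

lemma pseudoHyperbolicDist_lt_one {z w : ℂ} (hz : ‖z‖ < 1) (hw : ‖w‖ < 1) :
    pseudoHyperbolicDist z w < 1 := by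
  have h := one_sub_pseudoHyperbolicDist_sq hz hw
  have h0 : 0 < ‖1 - z * (starRingEnd ℂ) w‖ := norm_pos_iff.2 (one_sub_mul_conj_ne_zero hz hw)
  have : 0 < 1 - pseudoHyperbolicDist z w ^ 2 := by
    rw [h]
    have := one_sub_norm_sq_pos hz
    have := one_sub_norm_sq_pos hw
    positivity
  nlinarith [pseudoHyperbolicDist_nonneg z w]

lemma pseudoHyperbolicDist_pos {z w : ℂ} (hz : ‖z‖ < 1) (hw : ‖w‖ < 1) (h : z ≠ w) :
    0 < pseudoHyperbolicDist z w :=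
  norm_pos_iff.2 (div_ne_zero (sub_ne_zero.2 h) (one_sub_mul_conj_ne_zero hz hw))

/-- A weak triangle inequality: two points that are both close to `u` are close to each other.
It holds because a disc automorphism moving `u` to `0` preserves the pseudo-hyperbolic distance. -/
lemma pseudoHyperbolicDist_le_of_le {z w u : ℂ} {η : ℝ} (hz : ‖z‖ < 1) (hw : ‖w‖ < 1)
    (hu : ‖u‖ < 1) (hη : η ≤ 1 / 2) (h₁ : pseudoHyperbolicDist z u ≤ η)
    (h₂ : pseudoHyperbolicDist w u ≤ η) : pseudoHyperbolicDist z w ≤ 4 * η := by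
  have hzu := one_sub_mul_conj_ne_zero hz hu
  have hwu := one_sub_mul_conj_ne_zero hw hu
  have huw := one_sub_mul_conj_ne_zero hu hw
  have hzw := one_sub_mul_conj_ne_zero hz hw
  set x := (z - u) / (1 - z * (starRingEnd ℂ) u) with hx
  set y := (w - u) / (1 - w * (starRingEnd ℂ) u) with hy
  have hxη : ‖x‖ ≤ η := h₁
  have hyη : ‖y‖ ≤ η := h₂
  -- the automorphism `z ↦ x` preserves the pseudo-hyperbolic distance
  have hu' : (1 - u * (starRingEnd ℂ) u) ≠ 0 := one_sub_mul_conj_ne_zero hu hu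
  have e1 : x - y = (z - w) * (1 - u * (starRingEnd ℂ) u) /
      ((1 - z * (starRingEnd ℂ) u) * (1 - w * (starRingEnd ℂ) u)) := by
    rw [hx, hy, div_sub_div _ _ hzu hwu]; congr 1; ring
  have e2 : 1 - x * (starRingEnd ℂ) y =
      (1 - z * (starRingEnd ℂ) w) * (1 - u * (starRingEnd ℂ) u) /
      ((1 - z * (starRingEnd ℂ) u) * (1 - u * (starRingEnd ℂ) w)) := by
    rw [hx, hy]
    simp only [map_div₀, map_sub, map_one, map_mul, Complex.conj_conj]
    have : 1 - (starRingEnd ℂ) w * u ≠ 0 := by rwa [mul_comm]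
    field_simp; ring
  have hn : ‖1 - u * (starRingEnd ℂ) w‖ = ‖1 - w * (starRingEnd ℂ) u‖ := by
    rw [← RCLike.norm_conj]; simp [mul_comm]
  have e3 : pseudoHyperbolicDist z w = ‖x - y‖ / ‖1 - x * (starRingEnd ℂ) y‖ := by
    rw [e1, e2, pseudoHyperbolicDist]
    simp only [norm_div, norm_mul, hn]
    have a1 := norm_ne_zero_iff.2 hzu
    have a2 := norm_ne_zero_iff.2 hwu
    have a3 := norm_ne_zero_iff.2 hzw
    have a4 := norm_ne_zero_iff.2 hu'
    field_simp
  have hd : 3 / 4 ≤ ‖1 - x * (starRingEnd ℂ) y‖ := by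
    have h := norm_sub_norm_le (1 : ℂ) (x * (starRingEnd ℂ) y)
    rw [norm_one, norm_mul, RCLike.norm_conj] at h
    nlinarith [norm_nonneg x, norm_nonneg y]
  rw [e3, div_le_iff₀ (by linarith)]
  have := norm_sub_le x y
  nlinarith [norm_nonneg x]

/-- Away from the diagonal, `log (1 / ρ)` is comparable to `1 - ρ ^ 2`. -/
lemma neg_log_pseudoHyperbolicDist_le {z a : ℂ} {δ : ℝ} (hz : ‖z‖ < 1) (ha : ‖a‖ < 1)
    (hδ : 0 < δ) (h : δ ≤ pseudoHyperbolicDist z a) :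
    -Real.log (pseudoHyperbolicDist z a) ≤ (1 - pseudoHyperbolicDist z a ^ 2) / (2 * δ ^ 2) := by
  set r := pseudoHyperbolicDist z a
  have hr : 0 < r := hδ.trans_le h
  have hr1 : r < 1 := pseudoHyperbolicDist_lt_one hz ha
  have h1 := Real.log_le_sub_one_of_pos (x := (r ^ 2)⁻¹) (by positivity)
  rw [Real.log_inv, Real.log_pow] at h1
  have h2 : (r ^ 2)⁻¹ - 1 ≤ (1 - r ^ 2) / δ ^ 2 := by
    have : (r ^ 2)⁻¹ - 1 = (1 - r ^ 2) / r ^ 2 := by field_simp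
    rw [this]
    have : 0 ≤ 1 - r ^ 2 := by nlinarith
    gcongr
  have h3 : (1 - r ^ 2) / (2 * δ ^ 2) = (1 - r ^ 2) / δ ^ 2 / 2 := by field_simp
  push_cast at h1
  linarith

/-- The weight `1 - |a| ^ 2` of a zero `a` is controlled by its Green function
`log (1 / ρ(w, a))` with an arbitrary pole `w`. -/
lemma one_sub_norm_sq_le_neg_log {w a : ℂ} (hw : ‖w‖ < 1) (ha : ‖a‖ < 1) (hne : w ≠ a) :
    1 - ‖a‖ ^ 2 ≤ 8 / (1 - ‖w‖) * -Real.log (pseudoHyperbolicDist w a) := by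
  have hr := pseudoHyperbolicDist_pos hw ha hne
  have h1 := Real.log_le_sub_one_of_pos (x := pseudoHyperbolicDist w a ^ 2) (by positivity)
  rw [Real.log_pow] at h1
  have h2 := one_sub_pseudoHyperbolicDist_sq hw ha
  have h0 : 0 < ‖1 - w * (starRingEnd ℂ) a‖ := norm_pos_iff.2 (one_sub_mul_conj_ne_zero hw ha)
  have h3 := norm_one_sub_mul_conj_le_two hw ha
  have hA := one_sub_norm_sq_pos ha
  have h4 : (1 - ‖w‖) * (1 - ‖a‖ ^ 2) / 4 ≤
      (1 - ‖w‖ ^ 2) * (1 - ‖a‖ ^ 2) / ‖1 - w * (starRingEnd ℂ) a‖ ^ 2 := by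
    have := one_sub_norm_sq_pos hw
    apply div_le_div₀ (by positivity) _ (by positivity) (by nlinarith)
    exact mul_le_mul_of_nonneg_right (by nlinarith [norm_nonneg w]) hA.le
  have hw' : 0 < 1 - ‖w‖ := by linarith
  rw [div_mul_eq_mul_div, le_div_iff₀ hw']
  push_cast at h1
  nlinarith

/-- If `z` is pseudo-hyperbolically close to `a`, then `1 - |z|` is controlled by `1 - |a|`. -/
lemma one_sub_norm_le_of_pseudoHyperbolicDist_le {z a : ℂ} (hz : ‖z‖ < 1) (ha : ‖a‖ < 1)
    (h : pseudoHyperbolicDist z a ≤ 1 / 2) : 1 - ‖z‖ ≤ 3 * (1 - ‖a‖ ^ 2) := by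
  have h2 := one_sub_pseudoHyperbolicDist_sq hz ha
  have h0 : 0 < ‖1 - z * (starRingEnd ℂ) a‖ := norm_pos_iff.2 (one_sub_mul_conj_ne_zero hz ha)
  have h1 : 1 - ‖z‖ ≤ ‖1 - z * (starRingEnd ℂ) a‖ := by
    have h := norm_sub_norm_le (1 : ℂ) (z * (starRingEnd ℂ) a)
    rw [norm_one, norm_mul, RCLike.norm_conj] at h
    nlinarith [norm_nonneg a, norm_nonneg z]
  have h3 : 3 / 4 ≤ 1 - pseudoHyperbolicDist z a ^ 2 := by
    nlinarith [pseudoHyperbolicDist_nonneg z a]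
  rw [h2, le_div_iff₀ (by positivity)] at h3
  have hz' : 0 < 1 - ‖z‖ := by linarith
  have hA := one_sub_norm_sq_pos ha
  have h4 : 3 / 4 * (1 - ‖z‖) * (1 - ‖z‖) ≤ 2 * (1 - ‖a‖ ^ 2) * (1 - ‖z‖) := by
    calc 3 / 4 * (1 - ‖z‖) * (1 - ‖z‖) ≤ 3 / 4 * ‖1 - z * (starRingEnd ℂ) a‖ ^ 2 := by nlinarith
      _ ≤ _ := h3
      _ = (1 + ‖z‖) * (1 - ‖a‖ ^ 2) * (1 - ‖z‖) := by ring
      _ ≤ _ := by gcongr; linarith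
  have := le_of_mul_le_mul_right h4 hz'
  linarith

/-! ### Poisson kernels -/

lemma poissonKernel_zero_nonneg {z ζ : ℂ} (h : ‖z‖ ≤ ‖ζ‖) : 0 ≤ poissonKernel 0 z ζ := by
  rw [poissonKernel_def]
  simp only [sub_zero]
  have : ‖z‖ ^ 2 ≤ ‖ζ‖ ^ 2 := by gcongr
  exact div_nonneg (by linarith) (by positivity)

/-- As a function of `z`, the kernel `1 - ρ(z, a) ^ 2` is dominated by the point mass
`4 (1 - |a| ^ 2)` at the radial projection of `a` to the circle. -/
lemma exists_one_sub_pseudoHyperbolicDist_sq_le {a : ℂ} (ha : ‖a‖ < 1) :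
    ∃ ζ : ℂ, ‖ζ‖ = 1 ∧ ∀ z : ℂ, ‖z‖ < 1 →
      1 - pseudoHyperbolicDist z a ^ 2 ≤ 4 * (1 - ‖a‖ ^ 2) * poissonKernel 0 z ζ := by
  obtain ⟨ζ, hζ, hζa⟩ : ∃ ζ : ℂ, ‖ζ‖ = 1 ∧ ‖ζ - a‖ = 1 - ‖a‖ := by
    by_cases h : a = 0
    · exact ⟨1, by simp, by simp [h]⟩
    · have h0 : ‖a‖ ≠ 0 := norm_ne_zero_iff.2 h
      refine ⟨((‖a‖⁻¹ : ℝ) : ℂ) * a, ?_, ?_⟩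
      · rw [norm_mul, Complex.norm_real]; simp [h0]
      · have : ((‖a‖⁻¹ : ℝ) : ℂ) * a - a = ((‖a‖⁻¹ - 1 : ℝ) : ℂ) * a := by push_cast; ring
        rw [this, norm_mul, Complex.norm_real, Real.norm_eq_abs, abs_of_nonneg]
        · field_simp
        · have := (one_le_inv₀ (norm_pos_iff.2 h)).2 ha.le
          linarith
  refine ⟨ζ, hζ, fun z hz => ?_⟩
  rw [one_sub_pseudoHyperbolicDist_sq hz ha, poissonKernel_def]
  simp only [sub_zero, hζ]
  have hD : 0 < ‖1 - z * (starRingEnd ℂ) a‖ := norm_pos_iff.2 (one_sub_mul_conj_ne_zero hz ha)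
  have hE : 0 < ‖ζ - z‖ := norm_pos_iff.2 (by rintro h; rw [sub_eq_zero.1 h] at hζ; linarith)
  have key : ‖ζ - z‖ ≤ 2 * ‖1 - z * (starRingEnd ℂ) a‖ := by
    have e : ‖ζ - z‖ = ‖1 - z * (starRingEnd ℂ) ζ‖ := by
      have : ζ * (starRingEnd ℂ) ζ = 1 := by
        rw [Complex.mul_conj, Complex.normSq_eq_norm_sq, hζ]; simp
      rw [← this, ← sub_mul, norm_mul, RCLike.norm_conj, hζ, mul_one]
    have e2 : 1 - z * (starRingEnd ℂ) ζ =
        (1 - z * (starRingEnd ℂ) a) - z * (starRingEnd ℂ) (ζ - a) := by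
      rw [map_sub]; ring
    rw [e, e2]
    refine (norm_sub_le _ _).trans ?_
    rw [norm_mul, RCLike.norm_conj, hζa]
    have := one_sub_norm_le_norm_one_sub_mul_conj (w := a) hz
    nlinarith [norm_nonneg z]
  have hA := one_sub_norm_sq_pos ha
  have hZ := one_sub_norm_sq_pos hz
  rw [one_pow, mul_div_assoc', div_le_div_iff₀ (by positivity) (by positivity)]
  have : ‖ζ - z‖ ^ 2 ≤ 4 * ‖1 - z * (starRingEnd ℂ) a‖ ^ 2 := by nlinarith
  calc (1 - ‖z‖ ^ 2) * (1 - ‖a‖ ^ 2) * ‖ζ - z‖ ^ 2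
      ≤ (1 - ‖z‖ ^ 2) * (1 - ‖a‖ ^ 2) * (4 * ‖1 - z * (starRingEnd ℂ) a‖ ^ 2) := by gcongr
    _ = _ := by ring

/-- Passing from the unit circle to a concentric circle of radius `R` close to `1` costs at most a
factor `4` in the Poisson kernel. -/
lemma poissonKernel_zero_smul_le {z ζ : ℂ} {R : ℝ} (hζ : ‖ζ‖ = 1) (hR : R < 1)
    (hz : 1 + ‖z‖ ≤ 2 * R) : poissonKernel 0 z (R * ζ) ≤ 4 * poissonKernel 0 z ζ := by
  have hR0 : 0 < R := by nlinarith [norm_nonneg z]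
  have hRζ : ‖(R : ℂ) * ζ‖ = R := by
    rw [norm_mul, hζ, Complex.norm_real, Real.norm_of_nonneg hR0.le, mul_one]
  rw [poissonKernel_def, poissonKernel_def]
  simp only [sub_zero, hζ, hRζ]
  have h1 : R - ‖z‖ ≤ ‖R * ζ - z‖ := by
    have := norm_sub_norm_le (R * ζ) z
    rwa [hRζ] at this
  have h2 : ‖ζ - z‖ ≤ 2 * ‖R * ζ - z‖ := by
    have e : ζ - z = (R * ζ - z) + ((1 - R : ℝ) : ℂ) * ζ := by push_cast; ring
    rw [e]
    refine (norm_add_le _ _).trans ?_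
    rw [norm_mul, hζ, Complex.norm_real, Real.norm_of_nonneg (by linarith)]
    linarith
  have hE : 0 < ‖ζ - z‖ := norm_pos_iff.2 (by rintro h; rw [sub_eq_zero.1 h] at hζ; linarith)
  have hE' : 0 < ‖R * ζ - z‖ := by linarith
  rw [one_pow, mul_div_assoc', div_le_div_iff₀ (by positivity) (by positivity)]
  have : ‖ζ - z‖ ^ 2 ≤ 4 * ‖R * ζ - z‖ ^ 2 := by nlinarith
  have hz2 : 0 ≤ R ^ 2 - ‖z‖ ^ 2 := by nlinarith [norm_nonneg z]
  calc (R ^ 2 - ‖z‖ ^ 2) * ‖ζ - z‖ ^ 2 ≤ (R ^ 2 - ‖z‖ ^ 2) * (4 * ‖R * ζ - z‖ ^ 2) := by gcongr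
    _ ≤ (1 - ‖z‖ ^ 2) * (4 * ‖R * ζ - z‖ ^ 2) := by gcongr; nlinarith
    _ = _ := by ring

/-- A lower bound for the Poisson kernel on a circle of radius `R` close to `1`. -/
lemma le_poissonKernel_zero {w z : ℂ} {R : ℝ} (hw : 1 + ‖w‖ ≤ 2 * R) (hR : R < 1)
    (hz : ‖z‖ = R) : (1 - ‖w‖) / 4 ≤ poissonKernel 0 w z := by
  have h := le_re_herglotzRieszKernel (c := 0) (R := R) (w := w) (z := z) (by simpa using hz)
    (by simp; linarith)
  rw [poissonKernel_eq_re_herglotzRieszKernel, Function.comp_apply, herglotzRieszKernel_def]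
  refine le_trans ?_ h
  simp only [sub_zero]
  rw [div_le_div_iff₀ (by norm_num) (by linarith [norm_nonneg w])]
  nlinarith [norm_nonneg w]

/-! ### Dividing out zeros -/

/-- **Schwarz lemma**, centred at a zero `a`: a function bounded by `1` which vanishes at `a` is
bounded by the pseudo-hyperbolic distance to `a`. -/
lemma norm_le_pseudoHyperbolicDist {f : ℂ → ℂ} (hf : DifferentiableOn ℂ f (Metric.ball 0 1))
    (hb : ∀ z ∈ Metric.ball (0 : ℂ) 1, ‖f z‖ ≤ 1) {a z : ℂ} (ha : ‖a‖ < 1) (hfa : f a = 0)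
    (hz : ‖z‖ < 1) : ‖f z‖ ≤ pseudoHyperbolicDist z a := by
  set φ : ℂ → ℂ := fun w => (w + a) / (1 + w * (starRingEnd ℂ) a) with hφ
  have hden : ∀ w : ℂ, ‖w‖ < 1 → 1 + w * (starRingEnd ℂ) a ≠ 0 := fun w hw => by
    simpa using one_sub_mul_conj_ne_zero (z := w) (w := -a) hw (by simpa using ha)
  have hmaps : Set.MapsTo φ (Metric.ball 0 1) (Metric.ball 0 1) := fun w hw => by
    rw [mem_ball_zero_iff] at hw ⊢
    have h := pseudoHyperbolicDist_lt_one (z := w) (w := -a) hw (by simpa using ha)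
    simpa [pseudoHyperbolicDist, hφ] using h
  have hφd : DifferentiableOn ℂ φ (Metric.ball 0 1) := by
    refine DifferentiableOn.div (by fun_prop) (by fun_prop) fun w hw => hden w ?_
    simpa using hw
  have hzden := one_sub_mul_conj_ne_zero hz ha
  have hx : ‖(z - a) / (1 - z * (starRingEnd ℂ) a)‖ < 1 := pseudoHyperbolicDist_lt_one hz ha
  have hφz : φ ((z - a) / (1 - z * (starRingEnd ℂ) a)) = z := by
    have h1 := hden _ hx
    have haa : 1 - a * (starRingEnd ℂ) a ≠ 0 := one_sub_mul_conj_ne_zero ha ha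
    rw [hφ]
    simp only
    rw [div_eq_iff h1]
    have e : (z - a) / (1 - z * (starRingEnd ℂ) a) * (1 - z * (starRingEnd ℂ) a) = z - a :=
      div_mul_cancel₀ _ hzden
    linear_combination e
  have h := Complex.norm_le_norm_of_mapsTo_ball (f := f ∘ φ) (R := 1)
    (z := (z - a) / (1 - z * (starRingEnd ℂ) a)) (hf.comp hφd hmaps)
    (fun w hw => by simpa using hb _ (hmaps hw)) (by simp [hφ, hfa]) hx
  rwa [Function.comp_apply, hφz] at h

/-- A zero of a bounded function can be divided out by a Blaschke factor without increasing the
bound. -/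
lemma exists_eq_blaschkeFactor_mul {f : ℂ → ℂ} (hf : DifferentiableOn ℂ f (Metric.ball 0 1))
    (hb : ∀ z ∈ Metric.ball (0 : ℂ) 1, ‖f z‖ ≤ 1) {a : ℂ} (ha : ‖a‖ < 1) (hfa : f a = 0) :
    ∃ g : ℂ → ℂ, DifferentiableOn ℂ g (Metric.ball 0 1) ∧
      (∀ z ∈ Metric.ball (0 : ℂ) 1, ‖g z‖ ≤ 1) ∧
      ∀ z ∈ Metric.ball (0 : ℂ) 1, f z = (z - a) / (1 - z * (starRingEnd ℂ) a) * g z := by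
  have hab : Metric.ball (0 : ℂ) 1 ∈ nhds a := Metric.isOpen_ball.mem_nhds (by simpa using ha)
  set g : ℂ → ℂ := fun z => dslope f a z * (1 - z * (starRingEnd ℂ) a) with hg
  have hgd : DifferentiableOn ℂ g (Metric.ball 0 1) :=
    ((Complex.differentiableOn_dslope hab).2 hf).mul (by fun_prop)
  have hfg : ∀ z ∈ Metric.ball (0 : ℂ) 1,
      f z = (z - a) / (1 - z * (starRingEnd ℂ) a) * g z := fun z hz => by
    have h0 := one_sub_mul_conj_ne_zero (mem_ball_zero_iff.1 hz) ha
    have h1 := sub_smul_dslope f a z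
    rw [hfa, sub_zero, smul_eq_mul] at h1
    rw [hg, ← h1]
    field_simp
  have hne : ∀ z ∈ Metric.ball (0 : ℂ) 1, z ≠ a → ‖g z‖ ≤ 1 := fun z hz hza => by
    rw [mem_ball_zero_iff] at hz
    have h := norm_le_pseudoHyperbolicDist hf hb ha hfa hz
    rw [hfg z (by simpa using hz), norm_mul] at h
    have hp := pseudoHyperbolicDist_pos hz ha hza
    exact le_of_mul_le_mul_left (by simpa [pseudoHyperbolicDist] using h) hp
  refine ⟨g, hgd, fun z hz => ?_, hfg⟩
  rcases eq_or_ne z a with rfl | hza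
  · have hc : Filter.Tendsto (fun w => ‖g w‖) (nhdsWithin z {z}ᶜ) (nhds ‖g z‖) :=
      ((hgd.differentiableAt hab).continuousAt.norm.tendsto).mono_left nhdsWithin_le_nhds
    refine le_of_tendsto hc ?_
    filter_upwards [nhdsWithin_le_nhds hab, self_mem_nhdsWithin] with w hw hwz
    exact hne w hw hwz
  · exact hne z hz hza

/-- Jensen's inequality, with an arbitrary base point `w`, for a finite set of zeros. -/
lemma sum_neg_log_pseudoHyperbolicDist_le {w : ℂ} (hw : ‖w‖ < 1) (s : Finset ℂ) :
    ∀ f : ℂ → ℂ, DifferentiableOn ℂ f (Metric.ball 0 1) →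
      (∀ z ∈ Metric.ball (0 : ℂ) 1, ‖f z‖ ≤ 1) → f w ≠ 0 → (∀ a ∈ s, ‖a‖ < 1 ∧ f a = 0) →
      ∑ a ∈ s, -Real.log (pseudoHyperbolicDist w a) ≤ -Real.log ‖f w‖ := by
  have hwb : w ∈ Metric.ball (0 : ℂ) 1 := by simpa using hw
  induction s using Finset.induction_on with
  | empty =>
    intro f _ hb _ _
    simpa using Real.log_nonpos (norm_nonneg _) (hb w hwb)
  | insert a s has ih =>
    intro f hf hb hfw hs
    obtain ⟨ha, hfa⟩ := hs a (Finset.mem_insert_self a s)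
    obtain ⟨g, hg, hgb, hfg⟩ := exists_eq_blaschkeFactor_mul hf hb ha hfa
    have hwa : w ≠ a := by rintro rfl; exact hfw hfa
    have hgw : g w ≠ 0 := fun h => hfw (by rw [hfg w hwb, h, mul_zero])
    have h := ih g hg hgb hgw fun b hbs => by
      obtain ⟨hb1, hfb⟩ := hs b (Finset.mem_insert_of_mem hbs)
      refine ⟨hb1, ?_⟩
      rw [hfg b (by simpa using hb1)] at hfb
      refine (mul_eq_zero.1 hfb).resolve_left (div_ne_zero (sub_ne_zero.2 ?_)
        (one_sub_mul_conj_ne_zero hb1 ha))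
      rintro rfl
      exact has hbs
    rw [Finset.sum_insert has, hfg w hwb, norm_mul, ← pseudoHyperbolicDist, Real.log_mul
      (pseudoHyperbolicDist_pos hw ha hwa).ne' (norm_ne_zero_iff.2 hgw), neg_add]
    exact add_le_add le_rfl h

/-! ### Balayage sums of `log (1 / |f|)` -/

/-- The Poisson integral formula bounds balayage sums of the positive harmonic function
`log (1 / |g|)`, for a zero-free `g`, by its value at a fixed point `w`. -/
lemma sum_neg_log_norm_le_of_ne_zero {ι : Type*} {F : Finset ι} {γ : ι → ℂ} {c : ι → ℝ} {S R : ℝ}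
    {w : ℂ} {g : ℂ → ℂ} (hg : DifferentiableOn ℂ g (Metric.ball 0 1))
    (hb : ∀ z ∈ Metric.ball (0 : ℂ) 1, ‖g z‖ ≤ 1) (hR : R < 1) (hw : 1 + ‖w‖ ≤ 2 * R)
    (h0 : ∀ z, ‖z‖ ≤ R → g z ≠ 0) (hc : ∀ i ∈ F, 0 ≤ c i)
    (hγ : ∀ i ∈ F, ‖γ i‖ < 1 ∧ 1 + ‖γ i‖ ≤ 2 * R)
    (hS0 : 0 ≤ S) (hS : ∀ ζ : ℂ, ‖ζ‖ = 1 → ∑ i ∈ F, c i * poissonKernel 0 (γ i) ζ ≤ S) :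
    ∑ i ∈ F, c i * -Real.log ‖g (γ i)‖ ≤ 16 / (1 - ‖w‖) * S * -Real.log ‖g w‖ := by
  have hR0 : 0 < R := by linarith [norm_nonneg w]
  have hw1 : 0 < 1 - ‖w‖ := by linarith
  set u : ℂ → ℝ := fun z => -Real.log ‖g z‖ with hu
  have hharm : InnerProductSpace.HarmonicOnNhd u (Metric.closedBall 0 R) := fun z hz => by
    have hz' : ‖z‖ ≤ R := by simpa using hz
    have hzb : Metric.ball (0 : ℂ) 1 ∈ nhds z :=
      Metric.isOpen_ball.mem_nhds (by simpa using hz'.trans_lt hR)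
    exact ((hg.analyticAt hzb).harmonicAt_log_norm (h0 z hz')).neg
  have hu0 : ∀ z, ‖z‖ ≤ R → 0 ≤ u z := fun z hz =>
    neg_nonneg.2 (Real.log_nonpos (norm_nonneg _) (hb z (by simpa using hz.trans_lt hR)))
  have hucont : ContinuousOn u (Metric.sphere 0 |R|) := fun z hz => by
    have hz' : z ∈ Metric.closedBall (0 : ℂ) R := by
      rw [abs_of_pos hR0] at hz
      exact Metric.sphere_subset_closedBall hz
    exact (hharm z hz').1.continuousAt.continuousWithinAt
  have hPcont : ∀ z : ℂ, ‖z‖ < R →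
      ContinuousOn (poissonKernel 0 z) (Metric.sphere 0 |R|) := fun z hz => by
    rw [poissonKernel_eq_re_herglotzRieszKernel]
    exact Complex.continuous_re.comp_continuousOn
      (continuousOn_herglotzRieszKernel_sphere (by simpa using hz))
  have hPint : ∀ (k : ℝ) (z : ℂ), ‖z‖ < R →
      CircleIntegrable (k • (poissonKernel 0 z • u)) 0 R := fun k z hz =>
    (continuousOn_const.smul ((hPcont z hz).smul hucont)).circleIntegrable'
  have hPoisson : ∀ z : ℂ, ‖z‖ < R →
      Real.circleAverage (poissonKernel 0 z • u) 0 R = u z := fun z hz =>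
    hharm.circleAverage_poissonKernel_smul (by simpa using hz)
  have hγR : ∀ i ∈ F, ‖γ i‖ < R := fun i hi => by
    have := hγ i hi
    linarith
  have hwR : ‖w‖ < R := by linarith
  have e1 : ∑ i ∈ F, c i * u (γ i) =
      Real.circleAverage (∑ i ∈ F, c i • (poissonKernel 0 (γ i) • u)) 0 R := by
    rw [Real.circleAverage_sum fun i hi => hPint (c i) (γ i) (hγR i hi)]
    refine Finset.sum_congr rfl fun i hi => ?_
    rw [Real.circleAverage_smul, hPoisson _ (hγR i hi), smul_eq_mul]
  have e2 : 16 / (1 - ‖w‖) * S * u w =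
      Real.circleAverage ((16 / (1 - ‖w‖) * S) • (poissonKernel 0 w • u)) 0 R := by
    rw [Real.circleAverage_smul, hPoisson _ hwR, smul_eq_mul]
  change ∑ i ∈ F, c i * u (γ i) ≤ 16 / (1 - ‖w‖) * S * u w
  rw [e1, e2]
  refine Real.circleAverage_mono (CircleIntegrable.sum _ fun i hi => hPint (c i) (γ i) (hγR i hi))
    (hPint _ w hwR) fun z hz => ?_
  have hzR : ‖z‖ = R := by simpa [abs_of_pos hR0] using hz
  have hζ : ‖((R⁻¹ : ℝ) : ℂ) * z‖ = 1 := by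
    rw [norm_mul, Complex.norm_real, Real.norm_of_nonneg (by positivity), hzR]
    field_simp
  have hzζ : (R : ℂ) * (((R⁻¹ : ℝ) : ℂ) * z) = z := by
    push_cast
    field_simp [hR0.ne']
  have hsum : ∑ i ∈ F, c i * poissonKernel 0 (γ i) z ≤ 4 * S := by
    calc ∑ i ∈ F, c i * poissonKernel 0 (γ i) z
        ≤ ∑ i ∈ F, c i * (4 * poissonKernel 0 (γ i) (((R⁻¹ : ℝ) : ℂ) * z)) := by
          refine Finset.sum_le_sum fun i hi => mul_le_mul_of_nonneg_left ?_ (hc i hi)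
          have := poissonKernel_zero_smul_le hζ hR (hγ i hi).2
          rwa [hzζ] at this
      _ = 4 * ∑ i ∈ F, c i * poissonKernel 0 (γ i) (((R⁻¹ : ℝ) : ℂ) * z) := by
          rw [Finset.mul_sum]
          exact Finset.sum_congr rfl fun i _ => by ring
      _ ≤ _ := by linarith [hS _ hζ]
  have hPw := le_poissonKernel_zero hw hR hzR
  simp only [Finset.sum_apply, Pi.smul_apply, Pi.mul_apply, smul_eq_mul]
  calc ∑ i ∈ F, c i * (poissonKernel 0 (γ i) z * u z)
      = (∑ i ∈ F, c i * poissonKernel 0 (γ i) z) * u z := by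
        rw [Finset.sum_mul]
        exact Finset.sum_congr rfl fun i _ => by ring
    _ ≤ 4 * S * u z := mul_le_mul_of_nonneg_right hsum (hu0 z hzR.le)
    _ = 16 / (1 - ‖w‖) * S * ((1 - ‖w‖) / 4 * u z) := by field_simp; ring
    _ ≤ 16 / (1 - ‖w‖) * S * (poissonKernel 0 w z * u z) := by
        refine mul_le_mul_of_nonneg_left ?_ (by positivity)
        exact mul_le_mul_of_nonneg_right hPw (hu0 z hzR.le)

/-- Balayage sums of the Green function `log (1 / ρ(·, a))` over points that stay away from `a`. -/
lemma sum_neg_log_pseudoHyperbolicDist_mul_le {ι : Type*} {F : Finset ι} {γ : ι → ℂ} {c : ι → ℝ}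
    {S δ : ℝ} {w a : ℂ} (hδ : 0 < δ) (hw : ‖w‖ < 1) (ha : ‖a‖ < 1) (hwa : w ≠ a)
    (hc : ∀ i ∈ F, 0 ≤ c i) (hγ : ∀ i ∈ F, ‖γ i‖ < 1)
    (hγa : ∀ i ∈ F, δ ≤ pseudoHyperbolicDist (γ i) a)
    (hS0 : 0 ≤ S) (hS : ∀ ζ : ℂ, ‖ζ‖ = 1 → ∑ i ∈ F, c i * poissonKernel 0 (γ i) ζ ≤ S) :
    ∑ i ∈ F, c i * -Real.log (pseudoHyperbolicDist (γ i) a) ≤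
      16 / (δ ^ 2 * (1 - ‖w‖)) * S * -Real.log (pseudoHyperbolicDist w a) := by
  obtain ⟨ζ, hζ, hP⟩ := exists_one_sub_pseudoHyperbolicDist_sq_le ha
  have hw' : 0 < 1 - ‖w‖ := by linarith
  have hA := one_sub_norm_sq_pos ha
  calc ∑ i ∈ F, c i * -Real.log (pseudoHyperbolicDist (γ i) a)
      ≤ ∑ i ∈ F, c i * (4 * (1 - ‖a‖ ^ 2) * poissonKernel 0 (γ i) ζ / (2 * δ ^ 2)) := by
        refine Finset.sum_le_sum fun i hi => mul_le_mul_of_nonneg_left ?_ (hc i hi)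
        refine (neg_log_pseudoHyperbolicDist_le (hγ i hi) ha hδ (hγa i hi)).trans ?_
        gcongr
        exact hP _ (hγ i hi)
    _ = 2 * (1 - ‖a‖ ^ 2) / δ ^ 2 * ∑ i ∈ F, c i * poissonKernel 0 (γ i) ζ := by
        rw [Finset.mul_sum]
        refine Finset.sum_congr rfl fun i _ => ?_
        field_simp
        ring
    _ ≤ 2 * (1 - ‖a‖ ^ 2) / δ ^ 2 * S := by
        refine mul_le_mul_of_nonneg_left (hS ζ hζ) (by positivity)
    _ ≤ 2 * (8 / (1 - ‖w‖) * -Real.log (pseudoHyperbolicDist w a)) / δ ^ 2 * S := by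
        gcongr
        exact one_sub_norm_sq_le_neg_log hw ha hwa
    _ = _ := by field_simp; ring

/-- Balayage sums of `log (1 / |f|)` over points that stay away from the zeros of `f`.
The zeros in the disc of radius `R` are divided out one by one; each division multiplies
`|f w| ^ 2` by at least `1 / q`, so the bound `q ^ n < |f w| ^ 2` allows fewer than `n` of them. -/
lemma sum_neg_log_norm_le_of_pow_lt {ι : Type*} {F : Finset ι} {γ : ι → ℂ} {c : ι → ℝ} {S δ R q : ℝ}
    {w : ℂ} (hδ : 0 < δ) (hδ1 : δ ≤ 1) (hR : R < 1) (hw : 1 + ‖w‖ ≤ 2 * R) (hq : 0 < q)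
    (hqR : ∀ a : ℂ, ‖a‖ ≤ R → pseudoHyperbolicDist w a ^ 2 ≤ q) (hc : ∀ i ∈ F, 0 ≤ c i)
    (hγ : ∀ i ∈ F, ‖γ i‖ < 1 ∧ 1 + ‖γ i‖ ≤ 2 * R) (hS0 : 0 ≤ S)
    (hS : ∀ ζ : ℂ, ‖ζ‖ = 1 → ∑ i ∈ F, c i * poissonKernel 0 (γ i) ζ ≤ S) (n : ℕ) :
    ∀ f : ℂ → ℂ, DifferentiableOn ℂ f (Metric.ball 0 1) →
      (∀ z ∈ Metric.ball (0 : ℂ) 1, ‖f z‖ ≤ 1) → q ^ n < ‖f w‖ ^ 2 →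
      (∀ i ∈ F, ∀ a : ℂ, ‖a‖ < 1 → f a = 0 → δ ≤ pseudoHyperbolicDist (γ i) a) →
      ∑ i ∈ F, c i * -Real.log ‖f (γ i)‖ ≤
        16 / (δ ^ 2 * (1 - ‖w‖)) * S * -Real.log ‖f w‖ := by
  have hw1 : ‖w‖ < 1 := by linarith
  have hw' : 0 < 1 - ‖w‖ := by linarith
  have hwb : w ∈ Metric.ball (0 : ℂ) 1 := by simpa using hw1
  induction n with
  | zero =>
    intro f _ hb h _
    have := hb w hwb
    rw [pow_zero] at h
    nlinarith [norm_nonneg (f w)]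
  | succ n ih =>
    intro f hf hb hn hfγ
    by_cases hzero : ∀ z, ‖z‖ ≤ R → f z ≠ 0
    · refine (sum_neg_log_norm_le_of_ne_zero hf hb hR hw hzero hc hγ hS0 hS).trans ?_
      have hl : 0 ≤ -Real.log ‖f w‖ := neg_nonneg.2 (Real.log_nonpos (norm_nonneg _) (hb w hwb))
      gcongr
      exact mul_le_of_le_one_left hw'.le (by nlinarith)
    · push Not at hzero
      obtain ⟨a, haR, hfa⟩ := hzero
      have ha : ‖a‖ < 1 := haR.trans_lt hR
      obtain ⟨g, hg, hgb, hfg⟩ := exists_eq_blaschkeFactor_mul hf hb ha hfa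
      have hfw : f w ≠ 0 := fun h => by
        rw [h, norm_zero] at hn
        have : 0 < q ^ (n + 1) := by positivity
        norm_num at hn
        linarith
      have hwa : w ≠ a := by rintro rfl; exact hfw hfa
      have hgw : g w ≠ 0 := fun h => hfw (by rw [hfg w hwb, h, mul_zero])
      have hnorm : ∀ z, ‖z‖ < 1 → ‖f z‖ = pseudoHyperbolicDist z a * ‖g z‖ := fun z hz => by
        rw [hfg z (by simpa using hz), norm_mul, pseudoHyperbolicDist]
      have hgn : q ^ n < ‖g w‖ ^ 2 := by
        rw [hnorm w hw1, mul_pow, pow_succ] at hn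
        have : pseudoHyperbolicDist w a ^ 2 * ‖g w‖ ^ 2 ≤ q * ‖g w‖ ^ 2 := by
          gcongr
          exact hqR a haR
        nlinarith
      have hgγ : ∀ i ∈ F, ∀ b : ℂ, ‖b‖ < 1 → g b = 0 → δ ≤ pseudoHyperbolicDist (γ i) b :=
        fun i hi b hb1 hgb0 => hfγ i hi b hb1 (by rw [hfg b (by simpa using hb1), hgb0, mul_zero])
      have h1 := ih g hg hgb hgn hgγ
      have h2 := sum_neg_log_pseudoHyperbolicDist_mul_le hδ hw1 ha hwa hc (fun i hi => (hγ i hi).1)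
        (fun i hi => hfγ i hi a ha hfa) hS0 hS
      have hsplit : ∀ z, ‖z‖ < 1 → f z ≠ 0 →
          -Real.log ‖f z‖ = -Real.log (pseudoHyperbolicDist z a) + -Real.log ‖g z‖ := by
        intro z hz hfz
        have h := hnorm z hz
        have h0 := norm_ne_zero_iff.2 hfz
        rw [h] at h0 ⊢
        rw [Real.log_mul (left_ne_zero_of_mul h0) (right_ne_zero_of_mul h0), neg_add]
      have hfγ0 : ∀ i ∈ F, f (γ i) ≠ 0 := fun i hi h => by
        have := hfγ i hi _ (hγ i hi).1 h
        rw [pseudoHyperbolicDist_self] at this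
        linarith
      rw [hsplit w hw1 hfw, mul_add]
      refine le_of_eq_of_le ?_ (add_le_add h2 h1)
      rw [← Finset.sum_add_distrib]
      refine Finset.sum_congr rfl fun i hi => ?_
      rw [hsplit _ (hγ i hi).1 (hfγ0 i hi), mul_add]

/-- Balayage sums of `log (1 / |f|)` over points that stay away from the zeros of `f`, with a
constant that depends neither on the points nor on the weights. -/
lemma sum_neg_log_norm_le {ι : Type*} {F : Finset ι} {γ : ι → ℂ} {c : ι → ℝ} {S δ : ℝ}
    {w : ℂ} {f : ℂ → ℂ} (hf : DifferentiableOn ℂ f (Metric.ball 0 1))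
    (hb : ∀ z ∈ Metric.ball (0 : ℂ) 1, ‖f z‖ ≤ 1) (hw : ‖w‖ < 1) (hfw : f w ≠ 0)
    (hδ : 0 < δ) (hδ1 : δ ≤ 1) (hc : ∀ i ∈ F, 0 ≤ c i) (hγ : ∀ i ∈ F, ‖γ i‖ < 1)
    (hfγ : ∀ i ∈ F, ∀ a : ℂ, ‖a‖ < 1 → f a = 0 → δ ≤ pseudoHyperbolicDist (γ i) a)
    (hS : ∀ ζ : ℂ, ‖ζ‖ = 1 → ∑ i ∈ F, c i * poissonKernel 0 (γ i) ζ ≤ S) :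
    ∑ i ∈ F, c i * -Real.log ‖f (γ i)‖ ≤
      16 / (δ ^ 2 * (1 - ‖w‖)) * S * -Real.log ‖f w‖ := by
  -- `R` depends on the finite family of points, but does not enter the constant
  obtain ⟨R, hR, hwR, hγR⟩ : ∃ R : ℝ, R < 1 ∧ 1 + ‖w‖ ≤ 2 * R ∧
      ∀ i ∈ F, 1 + ‖γ i‖ ≤ 2 * R := by
    have h1 : ∀ t : ℝ, t < 1 → ∀ᶠ R in nhdsWithin (1 : ℝ) (Set.Iio 1), 1 + t ≤ 2 * R :=
      fun t ht => by
        filter_upwards [nhdsWithin_le_nhds (lt_mem_nhds (show (1 + t) / 2 < 1 by linarith))]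
          with R hR
        linarith
    have h2 : ∀ᶠ R in nhdsWithin (1 : ℝ) (Set.Iio 1), ∀ i ∈ F, 1 + ‖γ i‖ ≤ 2 * R :=
      (Filter.eventually_all_finset F).2 fun i hi => h1 _ (hγ i hi)
    obtain ⟨R, hR⟩ := (((h1 _ hw).and h2).and
      (self_mem_nhdsWithin : ∀ᶠ R in nhdsWithin (1 : ℝ) (Set.Iio 1), R < 1)).exists
    exact ⟨R, hR.2, hR.1.1, hR.1.2⟩
  have hS0 : 0 ≤ S := by
    refine le_trans (Finset.sum_nonneg fun i hi => mul_nonneg (hc i hi) ?_) (hS 1 (by simp))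
    exact poissonKernel_zero_nonneg (by simpa using (hγ i hi).le)
  have hR0 : 0 < R := by linarith [norm_nonneg w]
  have hW := one_sub_norm_sq_pos hw
  have hW1 : 1 - ‖w‖ ^ 2 ≤ 1 := by nlinarith [norm_nonneg w]
  have hR2 : 0 < 1 - R ^ 2 := by nlinarith
  have hq0 : 0 < 1 - (1 - ‖w‖ ^ 2) * (1 - R ^ 2) / 4 := by nlinarith
  have hq1 : 1 - (1 - ‖w‖ ^ 2) * (1 - R ^ 2) / 4 < 1 := by nlinarith [mul_pos hW hR2]
  have hqR : ∀ a : ℂ, ‖a‖ ≤ R →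
      pseudoHyperbolicDist w a ^ 2 ≤ 1 - (1 - ‖w‖ ^ 2) * (1 - R ^ 2) / 4 := fun a haR => by
    have ha : ‖a‖ < 1 := haR.trans_lt hR
    have h := one_sub_pseudoHyperbolicDist_sq hw ha
    have h0 : 0 < ‖1 - w * (starRingEnd ℂ) a‖ := norm_pos_iff.2 (one_sub_mul_conj_ne_zero hw ha)
    have h1 := norm_one_sub_mul_conj_le_two hw ha
    have hA := one_sub_norm_sq_pos ha
    have h2 : (1 - ‖w‖ ^ 2) * (1 - R ^ 2) / 4 ≤
        (1 - ‖w‖ ^ 2) * (1 - ‖a‖ ^ 2) / ‖1 - w * (starRingEnd ℂ) a‖ ^ 2 :=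
      div_le_div₀ (by positivity) (by gcongr) (by positivity) (by nlinarith)
    linarith
  have hfw2 : 0 < ‖f w‖ ^ 2 := by positivity
  obtain ⟨n, hn⟩ := exists_pow_lt_of_lt_one hfw2 hq1
  exact sum_neg_log_norm_le_of_pow_lt hδ hδ1 hR hwR hq0 hqR hc
    (fun i hi => ⟨hγ i hi, hγR i hi⟩) hS0 hS n f hf hb hn hfγ

/-! ### From a bounded function to the balayage inequality -/

/-- The points of a separated sequence that are pseudo-hyperbolically close to the zero set of a
bounded function form a Blaschke sequence: different points are close to different zeros. -/
lemma isBlaschkeSeq_of_close_to_zeros {ι : Type*} {z : ι → ℂ} {f : ℂ → ℂ} {w : ℂ} {δ : ℝ}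
    (hf : DifferentiableOn ℂ f (Metric.ball 0 1))
    (hb : ∀ z ∈ Metric.ball (0 : ℂ) 1, ‖f z‖ ≤ 1) (hw : ‖w‖ < 1) (hfw : f w ≠ 0)
    (hz : ∀ i, ‖z i‖ < 1) (hδ : 0 < δ) (hδ1 : δ ≤ 1)
    (hsep : ∀ i j, i ≠ j → δ ≤ pseudoHyperbolicDist (z i) (z j))
    (hclose : ∀ i, ∃ a : ℂ, ‖a‖ < 1 ∧ f a = 0 ∧ pseudoHyperbolicDist (z i) a ≤ δ / 8) :
    IsBlaschkeSeq z := by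
  choose a ha hfa hza using hclose
  have hinj : Function.Injective a := fun i j hij => by
    by_contra hne
    have h1 := hsep i j hne
    have h2 := pseudoHyperbolicDist_le_of_le (hz i) (hz j) (ha i) (by linarith) (hza i)
      (by rw [hij]; exact hza j)
    linarith
  have hw' : 0 < 1 - ‖w‖ := by linarith
  refine summable_of_sum_le (c := 24 / (1 - ‖w‖) * -Real.log ‖f w‖)
    (fun i => by simpa using (hz i).le) fun s => ?_
  have hJ := sum_neg_log_pseudoHyperbolicDist_le hw (s.image a) f hf hb hfw fun b hb => by
    obtain ⟨i, _, rfl⟩ := Finset.mem_image.1 hb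
    exact ⟨ha i, hfa i⟩
  rw [Finset.sum_image hinj.injOn] at hJ
  calc ∑ i ∈ s, (1 - ‖z i‖)
      ≤ ∑ i ∈ s, 24 / (1 - ‖w‖) * -Real.log (pseudoHyperbolicDist w (a i)) := by
        refine Finset.sum_le_sum fun i _ => ?_
        have h1 := one_sub_norm_le_of_pseudoHyperbolicDist_le (hz i) (ha i)
          ((hza i).trans (by linarith))
        have h2 := one_sub_norm_sq_le_neg_log hw (ha i)
          (by intro h; exact hfw (by rw [h]; exact hfa i))
        have h3 : 24 / (1 - ‖w‖) * -Real.log (pseudoHyperbolicDist w (a i)) =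
          3 * (8 / (1 - ‖w‖) * -Real.log (pseudoHyperbolicDist w (a i))) := by ring
        linarith
    _ = 24 / (1 - ‖w‖) * ∑ i ∈ s, -Real.log (pseudoHyperbolicDist w (a i)) := by
        rw [Finset.mul_sum]
    _ ≤ _ := by gcongr

/-- The balayage inequality on a set of points that stay away from the zeros of `f`. -/
lemma balayageCondition_of_norm_le {ι : Type*} {z : ι → ℂ} {ε : ι → ℝ} {f : ℂ → ℂ} {w : ℂ} {δ : ℝ}
    (hf : DifferentiableOn ℂ f (Metric.ball 0 1))
    (hb : ∀ z ∈ Metric.ball (0 : ℂ) 1, ‖f z‖ ≤ 1) (hw : ‖w‖ < 1) (hfw : f w ≠ 0)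
    (hz : ∀ i, ‖z i‖ < 1) (hδ : 0 < δ) (hδ1 : δ ≤ 1)
    (hfz : ∀ i, ∀ a : ℂ, ‖a‖ < 1 → f a = 0 → δ ≤ pseudoHyperbolicDist (z i) a)
    (hfε : ∀ i, ‖f (z i)‖ ≤ ε i) : BalayageCondition z ε := by
  have hw' : 0 < 1 - ‖w‖ := by linarith
  set K := 16 / (δ ^ 2 * (1 - ‖w‖)) * -Real.log ‖f w‖ with hK
  have hK0 : 0 ≤ K := by
    have : 0 ≤ -Real.log ‖f w‖ :=
      neg_nonneg.2 (Real.log_nonpos (norm_nonneg _) (hb w (by simpa using hw)))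
    positivity
  -- `K` vanishes when `f` is unimodular at `w`, while the constant has to be positive
  refine ⟨K + 1, by linarith, fun c => ?_⟩
  -- the negative terms are dropped, so no indeterminate difference has to be considered
  have hpos : extendedSum (fun i => c i * Real.log (ε i)⁻¹) ≤
      ((∑' i, ENNReal.ofReal (c i * Real.log (ε i)⁻¹) : ℝ≥0∞) : EReal) := by
    rw [extendedSum]
    exact EReal.sub_le_of_le_add (le_add_of_nonneg_right (EReal.coe_ennreal_nonneg _))
  refine hpos.trans ?_
  have hC : ((K + 1 : ℝ) : EReal) = ((ENNReal.ofReal (K + 1) : ℝ≥0∞) : EReal) := by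
    rw [EReal.coe_ennreal_ofReal, max_eq_left (by linarith)]
  rw [hC, ← EReal.coe_ennreal_mul, EReal.coe_ennreal_le_coe_ennreal_iff]
  by_cases htop : supBalayage z c = ⊤
  · rw [htop, ENNReal.mul_top (by simpa using by linarith)]
    exact le_top
  rw [ENNReal.tsum_eq_iSup_sum]
  refine iSup_le fun F => ?_
  set S := (supBalayage z c).toReal with hSdef
  have hS : ∀ ζ : ℂ, ‖ζ‖ = 1 → ∑ i ∈ F, (c i : ℝ) * poissonKernel 0 (z i) ζ ≤ S := fun ζ hζ => by
    have hnn : ∀ i ∈ F, 0 ≤ (c i : ℝ) * poissonKernel 0 (z i) ζ := fun i _ =>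
      mul_nonneg (c i).2 (poissonKernel_zero_nonneg (by rw [hζ]; exact (hz i).le))
    have h1 : ENNReal.ofReal (∑ i ∈ F, (c i : ℝ) * poissonKernel 0 (z i) ζ) ≤
        supBalayage z c := by
      rw [ENNReal.ofReal_sum_of_nonneg hnn, supBalayage]
      refine (ENNReal.sum_le_tsum F).trans ?_
      exact le_iSup₂ (f := fun ζ (_ : ζ ∈ Metric.sphere (0 : ℂ) 1) =>
        ∑' i, ENNReal.ofReal (c i * poissonKernel 0 (z i) ζ)) ζ (by simpa using hζ)
    exact (ENNReal.ofReal_le_iff_le_toReal htop).1 h1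
  have hmain := sum_neg_log_norm_le hf hb hw hfw hδ hδ1 (fun i _ => (c i).2)
    (fun i _ => hz i) (fun i _ => hfz i) hS (F := F)
  have hle : ∀ i, ENNReal.ofReal (c i * Real.log (ε i)⁻¹) ≤
      ENNReal.ofReal (c i * -Real.log ‖f (z i)‖) := fun i => by
    refine ENNReal.ofReal_le_ofReal (mul_le_mul_of_nonneg_left ?_ (c i).2)
    have hfi : f (z i) ≠ 0 := fun h => by
      have := hfz i _ (hz i) h
      rw [pseudoHyperbolicDist_self] at this
      linarith
    rw [Real.log_inv]
    exact neg_le_neg (Real.log_le_log (norm_pos_iff.2 hfi) (hfε i))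
  calc ∑ i ∈ F, ENNReal.ofReal (c i * Real.log (ε i)⁻¹)
      ≤ ∑ i ∈ F, ENNReal.ofReal (c i * -Real.log ‖f (z i)‖) := Finset.sum_le_sum fun i _ => hle i
    _ = ENNReal.ofReal (∑ i ∈ F, c i * -Real.log ‖f (z i)‖) := by
        refine (ENNReal.ofReal_sum_of_nonneg fun i _ => mul_nonneg (c i).2 ?_).symm
        exact neg_nonneg.2 (Real.log_nonpos (norm_nonneg _) (hb _ (by simpa using hz i)))
    _ ≤ ENNReal.ofReal ((K + 1) * S) := by
        refine ENNReal.ofReal_le_ofReal (hmain.trans ?_)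
        have : 0 ≤ S := ENNReal.toReal_nonneg
        have e : 16 / (δ ^ 2 * (1 - ‖w‖)) * S * -Real.log ‖f w‖ = K * S := by rw [hK]; ring
        rw [e]
        nlinarith
    _ = ENNReal.ofReal (K + 1) * supBalayage z c := by
        rw [ENNReal.ofReal_mul (by linarith), hSdef, ENNReal.ofReal_toReal htop]

/-! ### Normal families -/

/-- **Cauchy's estimate** on the whole disc: the Taylor coefficients of a function bounded by `1`
are bounded by `1`. -/
lemma norm_taylorCoeff_le_one {f : ℂ → ℂ} (hf : DifferentiableOn ℂ f (Metric.ball 0 1))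
    (hb : ∀ z ∈ Metric.ball (0 : ℂ) 1, ‖f z‖ ≤ 1) (n : ℕ) :
    ‖(n.factorial : ℂ)⁻¹ * iteratedDeriv n f 0‖ ≤ 1 := by
  have h0 : (0 : ℝ) < n.factorial := by exact_mod_cast n.factorial_pos
  have hr : ∀ r ∈ Set.Ioo (0 : ℝ) 1, ‖iteratedDeriv n f 0‖ * r ^ n ≤ n.factorial := fun r hr => by
    have hsub : Metric.closedBall (0 : ℂ) r ⊆ Metric.ball 0 1 :=
      Metric.closedBall_subset_ball hr.2
    have h := Complex.norm_iteratedDeriv_le_of_forall_mem_sphere_norm_le (f := f) (c := 0) (C := 1)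
      n hr.1 ((hf.mono hsub).diffContOnCl_ball subset_rfl)
      fun z hz => hb z (hsub (Metric.sphere_subset_closedBall hz))
    rwa [mul_one, le_div_iff₀ (pow_pos hr.1 n)] at h
  have hlim : Filter.Tendsto (fun r : ℝ => ‖iteratedDeriv n f 0‖ * r ^ n)
      (nhdsWithin 1 (Set.Iio 1)) (nhds (‖iteratedDeriv n f 0‖ * 1 ^ n)) :=
    ((continuous_const.mul (continuous_pow n)).tendsto 1).mono_left nhdsWithin_le_nhds
  have h1 : ‖iteratedDeriv n f 0‖ * 1 ^ n ≤ n.factorial := by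
    refine le_of_tendsto hlim ?_
    filter_upwards [Ioo_mem_nhdsLT (show (0 : ℝ) < 1 by norm_num)] with r hr' using hr r hr'
  rw [norm_mul, norm_inv, Complex.norm_natCast, inv_mul_le_iff₀ h0]
  simpa using h1

/-- **Montel's theorem**, in the form that along an ultrafilter every family of holomorphic
functions bounded by `1` converges pointwise to a holomorphic function. The limit is the power
series whose coefficients are the limits of the Taylor coefficients. -/
lemma exists_differentiableOn_tendsto {α : Type*} (U : Ultrafilter α) {f : α → ℂ → ℂ}
    (hf : ∀ k, DifferentiableOn ℂ (f k) (Metric.ball 0 1))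
    (hb : ∀ k, ∀ z ∈ Metric.ball (0 : ℂ) 1, ‖f k z‖ ≤ 1) :
    ∃ g : ℂ → ℂ, DifferentiableOn ℂ g (Metric.ball 0 1) ∧
      ∀ z ∈ Metric.ball (0 : ℂ) 1, Filter.Tendsto (fun k => f k z) U (nhds (g z)) := by
  set a : ℕ → α → ℂ := fun n k => (n.factorial : ℂ)⁻¹ * iteratedDeriv n (f k) 0 with ha
  have ha1 : ∀ n k, ‖a n k‖ ≤ 1 := fun n k => norm_taylorCoeff_le_one (hf k) (hb k) n
  have hlim : ∀ n, ∃ b : ℂ, ‖b‖ ≤ 1 ∧ Filter.Tendsto (a n) U (nhds b) := fun n => by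
    obtain ⟨b, hb, hbU⟩ := (isCompact_closedBall (0 : ℂ) 1).ultrafilter_le_nhds (U.map (a n)) (by
      rw [Filter.le_principal_iff]
      exact Filter.mem_map.2 (Filter.univ_mem' fun k => by simpa using ha1 n k))
    exact ⟨b, by simpa using hb, hbU⟩
  choose b hb1 hbU using hlim
  refine ⟨fun z => ∑' n, b n * z ^ n, fun z hz => ?_, fun z hz => ?_⟩
  · obtain ⟨r, hzr, hr1⟩ := exists_between (mem_ball_zero_iff.1 hz)
    have hr0 : 0 ≤ r := (norm_nonneg z).trans hzr.le
    have hd : DifferentiableOn ℂ (fun z => ∑' n, b n * z ^ n) (Metric.ball 0 r) := by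
      refine Complex.differentiableOn_tsum_of_summable_norm
        (summable_geometric_of_lt_one hr0 hr1) (fun n => by fun_prop) Metric.isOpen_ball
        fun n w hw => ?_
      rw [norm_mul, norm_pow]
      have hw' : ‖w‖ ≤ r := (mem_ball_zero_iff.1 hw).le
      calc ‖b n‖ * ‖w‖ ^ n ≤ 1 * r ^ n := by gcongr; exact hb1 n
        _ = r ^ n := one_mul _
    exact (hd.differentiableAt (Metric.isOpen_ball.mem_nhds
      (by simpa using hzr))).differentiableWithinAt
  · have hz' : ‖z‖ < 1 := mem_ball_zero_iff.1 hz
    have h := tendsto_tsum_of_dominated_convergence (𝓕 := (U : Filter α))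
      (f := fun k n => a n k * z ^ n) (g := fun n => b n * z ^ n) (bound := fun n => ‖z‖ ^ n)
      (summable_geometric_of_lt_one (norm_nonneg z) hz')
      (fun n => (hbU n).mul tendsto_const_nhds)
      (Filter.Eventually.of_forall fun k n => by
        rw [norm_mul, norm_pow]
        exact mul_le_of_le_one_left (by positivity) (ha1 n k))
    refine h.congr fun k => ?_
    have := Complex.taylorSeries_eq_on_ball' hz (hf k)
    simpa [ha] using this

/-! ### Duality between balayage and positive harmonic functions -/

lemma extendedSum_eq_sum {ι : Type*} {a : ι → ℝ} {F : Finset ι} (h : ∀ i ∉ F, a i = 0) :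
    extendedSum a = ((∑ i ∈ F, a i : ℝ) : EReal) := by
  have key : ∀ x : ι → ℝ, (∀ i ∉ F, x i = 0) →
      ((∑' i, ENNReal.ofReal (x i) : ℝ≥0∞) : EReal) = ((∑ i ∈ F, max (x i) 0 : ℝ) : EReal) := by
    intro x hx
    have h1 : ∀ i, ENNReal.ofReal (x i) = ENNReal.ofReal (max (x i) 0) := fun i => by
      rcases le_total (x i) 0 with h | h
      · rw [max_eq_right h, ENNReal.ofReal_of_nonpos h, ENNReal.ofReal_zero]
      · rw [max_eq_left h]
    have hnn : ∀ i ∈ F, 0 ≤ max (x i) 0 := fun i _ => le_max_right _ _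
    rw [tsum_eq_sum (s := F) fun i hi => by rw [hx i hi, ENNReal.ofReal_zero],
      Finset.sum_congr rfl fun i _ => h1 i, ← ENNReal.ofReal_sum_of_nonneg hnn,
      EReal.coe_ennreal_ofReal, max_eq_left (Finset.sum_nonneg hnn)]
  rw [extendedSum, key a h, key (fun i => -a i) fun i hi => by rw [h i hi, neg_zero],
    ← EReal.coe_sub, ← Finset.sum_sub_distrib]
  congr 1
  refine Finset.sum_congr rfl fun i _ => ?_
  rcases le_total (a i) 0 with h | h
  · rw [max_eq_right h, max_eq_left (by linarith)]; ring
  · rw [max_eq_left h, max_eq_right (by linarith)]; ring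

/-- The holomorphic functions on the disc with nonnegative real part and value of real part `C`
at the origin. Their real parts are the positive harmonic functions `u` with `u 0 = C`. -/
def posRealPart (C : ℝ) : Set (ℂ → ℂ) :=
  {h | DifferentiableOn ℂ h (Metric.ball 0 1) ∧ (∀ z ∈ Metric.ball (0 : ℂ) 1, 0 ≤ (h z).re) ∧
    (h 0).re = C}

lemma convex_posRealPart (C : ℝ) : Convex ℝ (posRealPart C) := by
  rintro h ⟨hd, hp, h0⟩ k ⟨kd, kp, k0⟩ s t hs ht hst
  refine ⟨(hd.const_smul s).add (kd.const_smul t), fun z hz => ?_, ?_⟩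
  · have := hp z hz
    have := kp z hz
    simp only [Pi.add_apply, Pi.smul_apply, Complex.add_re, Complex.smul_re, smul_eq_mul]
    positivity
  · simp only [Pi.add_apply, Pi.smul_apply, Complex.add_re, Complex.smul_re, smul_eq_mul, h0, k0]
    rw [← add_mul, hst, one_mul]

/-- Herglotz kernels, whose real parts are Poisson kernels. -/
lemma smul_herglotzRieszKernel_mem_posRealPart {C : ℝ} (hC : 0 ≤ C) {ζ : ℂ} (hζ : ‖ζ‖ = 1) :
    (fun z => (C : ℂ) * herglotzRieszKernel 0 z ζ) ∈ posRealPart C := by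
  have hre : ∀ z, ((C : ℂ) * herglotzRieszKernel 0 z ζ).re = C * poissonKernel 0 z ζ := fun z => by
    rw [poissonKernel_eq_re_herglotzRieszKernel, Complex.re_ofReal_mul, Function.comp_apply]
  refine ⟨?_, fun z hz => ?_, ?_⟩
  · simp only [herglotzRieszKernel_def, sub_zero]
    refine DifferentiableOn.const_mul (DifferentiableOn.div (by fun_prop) (by fun_prop) ?_) _
    intro z hz h
    rw [mem_ball_zero_iff, ← sub_eq_zero.1 h] at hz
    linarith
  · rw [hre]
    refine mul_nonneg hC (poissonKernel_zero_nonneg ?_)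
    rw [hζ]
    exact (mem_ball_zero_iff.1 hz).le
  · rw [hre, poissonKernel_def]
    simp [hζ]

/-- Duality: the balayage inequality produces a positive harmonic function with `u 0 = C` which
majorizes `log (1 / ε) - 1` on a finite set of points. Otherwise a hyperplane separates the values
of such functions from the vectors above `log (1 / ε) - 1`; its coefficients have a sign and
violate the inequality. The loss of `1` makes the second set open. -/
lemma exists_mem_posRealPart_le {ι : Type*} {z : ι → ℂ} {ε : ι → ℝ} {C : ℝ} (hC : 0 < C)
    (hbal : ∀ c : ι → ℝ≥0, extendedSum (fun i => c i * Real.log (ε i)⁻¹) ≤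
      (C : EReal) * (supBalayage z c : EReal)) (hz : ∀ i, ‖z i‖ < 1) (F : Finset ι) :
    ∃ h ∈ posRealPart C, ∀ i ∈ F, Real.log (ε i)⁻¹ - 1 ≤ (h (z i)).re := by
  classical
  set b : F → ℝ := fun i => Real.log (ε i)⁻¹ with hb
  set V : Set (F → ℝ) := {v | ∀ i, b i - 1 < v i} with hV
  set T : Set (F → ℝ) := (fun h i => (h (z i)).re) '' posRealPart C with hT
  by_contra hcon
  have hdisj : Disjoint V T := by
    rw [Set.disjoint_left]
    rintro _ hv ⟨h, hh, rfl⟩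
    exact hcon ⟨h, hh, fun i hi => (hv ⟨i, hi⟩).le⟩
  have hVconv : Convex ℝ V := by
    rintro v hv v' hv' s t hs ht hst i
    have h1 := hv i
    have h2 := hv' i
    simp only [Pi.add_apply, Pi.smul_apply, smul_eq_mul]
    obtain rfl : t = 1 - s := by linarith
    rcases hs.eq_or_lt with rfl | hs'
    · simpa using h2
    · nlinarith
  have hVopen : IsOpen V := by
    rw [hV, Set.ofPred_forall]
    exact isOpen_iInter_of_finite fun i => isOpen_lt continuous_const (continuous_apply i)
  have hTconv : Convex ℝ T := by
    let L : (ℂ → ℂ) →ₗ[ℝ] (F → ℝ) :=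
      { toFun := fun h i => (h (z i)).re
        map_add' := fun h k => by ext i; simp
        map_smul' := fun s h => by ext i; simp }
    exact (convex_posRealPart C).linear_image L
  obtain ⟨φ, s, hφV, hφT⟩ := geometric_hahn_banach_open hVconv hVopen hTconv hdisj
  have hφ : ∀ v : F → ℝ, φ v = ∑ i, v i * φ (Pi.single i 1) := fun v => by
    conv_lhs => rw [← Finset.univ_sum_single v, map_sum]
    refine Finset.sum_congr rfl fun i _ => ?_
    rw [← smul_eq_mul, ← map_smul, ← Pi.single_smul, smul_eq_mul, mul_one]
  have hbs : φ b < s := hφV b fun i => by linarith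
  have hneg : ∀ i, φ (Pi.single i 1) ≤ 0 := fun i => by
    by_contra! hpos
    -- moving `b` this far in the direction `i` reaches the separating hyperplane
    have ht : 0 ≤ (s - φ b) / φ (Pi.single i 1) := div_nonneg (by linarith) hpos.le
    have h := hφV (b + ((s - φ b) / φ (Pi.single i 1)) • Pi.single i 1) fun j => by
      have : 0 ≤ (Pi.single i 1 : F → ℝ) j := by
        rw [Pi.single_apply]; split_ifs <;> norm_num
      simp only [Pi.add_apply, Pi.smul_apply, smul_eq_mul]
      nlinarith [mul_nonneg ht this]
    rw [map_add, map_smul, smul_eq_mul, div_mul_cancel₀ _ hpos.ne'] at h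
    linarith
  set c : ι → ℝ≥0 := fun j => if hj : j ∈ F then (-φ (Pi.single ⟨j, hj⟩ 1)).toNNReal else 0 with hc
  have hcF : ∀ i : F, (c i : ℝ) = -φ (Pi.single i 1) := fun i => by
    rw [hc]
    simp only [i.2, dif_pos]
    exact Real.coe_toNNReal _ (neg_nonneg.2 (hneg i))
  have hcn : ∀ j ∉ F, c j = 0 := fun j hj => by rw [hc]; simp [hj]
  have hsum : ∀ x : ι → ℝ, ∑ j ∈ F, (c j : ℝ) * x j = -φ fun i => x i := fun x => by
    rw [hφ, ← Finset.sum_coe_sort, ← Finset.sum_neg_distrib]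
    refine Finset.sum_congr rfl fun i _ => ?_
    rw [hcF]
    ring
  have hsup : supBalayage z c ≤ ENNReal.ofReal (-s / C) := by
    refine iSup₂_le fun ζ hζ => ?_
    have hζ1 : ‖ζ‖ = 1 := by simpa using hζ
    have hnn : ∀ j ∈ F, 0 ≤ (c j : ℝ) * poissonKernel 0 (z j) ζ := fun j _ =>
      mul_nonneg (c j).2 (poissonKernel_zero_nonneg (by rw [hζ1]; exact (hz j).le))
    rw [tsum_eq_sum (s := F) fun j hj => by rw [hcn j hj]; simp,
      ← ENNReal.ofReal_sum_of_nonneg hnn]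
    refine ENNReal.ofReal_le_ofReal ?_
    have h := hφT _ ⟨_, smul_herglotzRieszKernel_mem_posRealPart hC.le hζ1, rfl⟩
    have h2 := hsum fun j => ((C : ℂ) * herglotzRieszKernel 0 (z j) ζ).re
    simp only at h
    rw [le_div_iff₀ hC, mul_comm, Finset.mul_sum]
    have e : ∑ j ∈ F, C * ((c j : ℝ) * poissonKernel 0 (z j) ζ) =
        ∑ j ∈ F, (c j : ℝ) * ((C : ℂ) * herglotzRieszKernel 0 (z j) ζ).re := by
      refine Finset.sum_congr rfl fun j _ => ?_
      rw [poissonKernel_eq_re_herglotzRieszKernel, Complex.re_ofReal_mul, Function.comp_apply]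
      ring
    rw [e, h2]
    linarith
  have hs0 : 0 ≤ -s := by
    have h := hφT _ ⟨_, smul_herglotzRieszKernel_mem_posRealPart hC.le (ζ := 1) (by simp), rfl⟩
    have h2 := hsum fun j => ((C : ℂ) * herglotzRieszKernel 0 (z j) 1).re
    simp only at h
    have h3 : 0 ≤ ∑ j ∈ F, (c j : ℝ) * ((C : ℂ) * herglotzRieszKernel 0 (z j) 1).re :=
      Finset.sum_nonneg fun j _ => mul_nonneg (c j).2
        ((smul_herglotzRieszKernel_mem_posRealPart hC.le (ζ := 1) (by simp)).2.1 _
          (by simpa using hz j))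
    linarith
  have hfin := hbal c
  rw [extendedSum_eq_sum (F := F) fun j hj => by rw [hcn j hj]; simp, hsum] at hfin
  have h4 : (C : EReal) * (supBalayage z c : EReal) ≤ ((-s : ℝ) : EReal) := by
    have hCe : (C : EReal) = ((ENNReal.ofReal C : ℝ≥0∞) : EReal) := by
      rw [EReal.coe_ennreal_ofReal, max_eq_left hC.le]
    have hse : ((-s : ℝ) : EReal) = ((ENNReal.ofReal (-s) : ℝ≥0∞) : EReal) := by
      rw [EReal.coe_ennreal_ofReal, max_eq_left hs0]
    rw [hCe, hse, ← EReal.coe_ennreal_mul, EReal.coe_ennreal_le_coe_ennreal_iff]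
    calc ENNReal.ofReal C * supBalayage z c ≤ ENNReal.ofReal C * ENNReal.ofReal (-s / C) := by
          gcongr
      _ = ENNReal.ofReal (-s) := by
          rw [← ENNReal.ofReal_mul hC.le, mul_div_cancel₀ _ hC.ne']
  have h5 := EReal.coe_le_coe_iff.1 (hfin.trans h4)
  have h6 : (φ fun i : F => Real.log (ε i)⁻¹) = φ b := rfl
  linarith

/-! ### From the balayage inequality to a bounded function -/

/-- Finite Blaschke products of a Blaschke sequence without the zero at the origin are bounded
below at the origin. -/
lemma exists_pos_le_prod_norm {ι : Type*} {z : ι → ℂ} (hz : ∀ i, ‖z i‖ < 1)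
    (hB : IsBlaschkeSeq z) :
    ∃ m : ℝ, 0 < m ∧ ∀ s : Finset ι, (∀ i ∈ s, z i ≠ 0) → m ≤ ∏ i ∈ s, ‖z i‖ := by
  have hsum : Summable fun i => -Real.log ‖z i‖ := by
    have h := Real.summable_log_one_add_of_summable (f := fun i => -(1 - ‖z i‖)) (Summable.neg hB)
    refine h.neg.congr fun i => ?_
    congr 2
    ring
  refine ⟨Real.exp (-∑' i, -Real.log ‖z i‖), Real.exp_pos _, fun s hs => ?_⟩
  have h1 : ∑ i ∈ s, -Real.log ‖z i‖ ≤ ∑' i, -Real.log ‖z i‖ :=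
    hsum.sum_le_tsum s fun i _ => neg_nonneg.2 (Real.log_nonpos (norm_nonneg _) (hz i).le)
  have h2 : ∏ i ∈ s, ‖z i‖ = Real.exp (-∑ i ∈ s, -Real.log ‖z i‖) := by
    rw [Finset.sum_neg_distrib, neg_neg, Real.exp_sum]
    exact Finset.prod_congr rfl fun i hi => (Real.exp_log (norm_pos_iff.2 (hs i hi))).symm
  rw [h2]
  exact Real.exp_le_exp.2 (neg_le_neg h1)

/-- Interpolation of the smallness conditions at finitely many points, with bounds at the origin
that do not depend on the points: a finite Blaschke product times the exponential of a function
with negative real part. -/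
lemma exists_norm_le_on_finset {ι κ : Type*} {z : ι → ℂ} {x : κ → ℂ} {ε : κ → ℝ} {C m : ℝ}
    (hz : ∀ i, ‖z i‖ < 1) (hx : ∀ i, ‖x i‖ < 1) (hε : ∀ i, 0 < ε i)
    (hmz : ∀ s : Finset ι, (∀ i ∈ s, z i ≠ 0) → m ≤ ∏ i ∈ s, ‖z i‖)
    (hC : 0 < C) (hbal : ∀ c : κ → ℝ≥0, extendedSum (fun i => c i * Real.log (ε i)⁻¹) ≤
      (C : EReal) * (supBalayage x c : EReal))
    (s : Finset ι) (hs : ∀ i ∈ s, z i ≠ 0) (F : Finset κ) :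
    ∃ f : ℂ → ℂ, DifferentiableOn ℂ f (Metric.ball 0 1) ∧
      (∀ z ∈ Metric.ball (0 : ℂ) 1, ‖f z‖ ≤ 1) ∧ Real.exp (-1 - C) * m ≤ ‖f 0‖ ∧
      (∀ i ∈ s, f (z i) = 0) ∧ ∀ i ∈ F, ‖f (x i)‖ ≤ ε i := by
  obtain ⟨h, ⟨hd, hp, h0⟩, hF⟩ := exists_mem_posRealPart_le hC hbal hx F
  set P : ℂ → ℂ := fun w => ∏ i ∈ s, (w - z i) / (1 - w * (starRingEnd ℂ) (z i)) with hP
  have hP1 : ∀ w : ℂ, ‖w‖ < 1 → ‖P w‖ ≤ 1 := fun w hw => by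
    rw [hP, norm_prod]
    exact Finset.prod_le_one (fun i _ => norm_nonneg _) fun i _ =>
      (pseudoHyperbolicDist_lt_one hw (hz i)).le
  have hE : ∀ w, ‖Complex.exp (-1 - h w)‖ = Real.exp (-1 - (h w).re) := fun w => by
    rw [Complex.norm_exp]; simp
  refine ⟨fun w => Complex.exp (-1 - h w) * P w, ?_, fun w hw => ?_, ?_, fun i hi => ?_,
    fun i hi => ?_⟩
  · refine ((differentiableOn_const _).sub hd).cexp.mul ?_
    refine DifferentiableOn.fun_finsetProd fun i _ => ?_
    refine DifferentiableOn.div (by fun_prop) (by fun_prop) fun w hw => ?_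
    exact one_sub_mul_conj_ne_zero (by simpa using hw) (hz i)
  · rw [norm_mul, hE]
    refine mul_le_one₀ (Real.exp_le_one_iff.2 ?_) (norm_nonneg _) (hP1 w (by simpa using hw))
    linarith [hp w hw]
  · rw [norm_mul, hE, h0]
    gcongr
    refine (hmz s hs).trans_eq ?_
    simp [hP, norm_prod]
  · have : P (z i) = 0 := Finset.prod_eq_zero hi (by simp)
    simp [this]
  · rw [norm_mul, hE]
    refine (mul_le_of_le_one_right (Real.exp_pos _).le (hP1 _ (hx i))).trans ?_
    have h1 := hF i hi
    rw [Real.log_inv] at h1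
    calc Real.exp (-1 - (h (x i)).re) ≤ Real.exp (Real.log (ε i)) :=
          Real.exp_le_exp.2 (by linarith)
      _ = ε i := Real.exp_log (hε i)

/-- The passage to the limit from finitely many points to all of them. -/
lemma exists_norm_le_of_balayageCondition {ι κ : Type*} {z : ι → ℂ} {x : κ → ℂ} {ε : κ → ℝ}
    (hz : ∀ i, ‖z i‖ < 1) (hx : ∀ i, ‖x i‖ < 1) (hε : ∀ i, 0 < ε i)
    (hB : IsBlaschkeSeq z) (hbal : BalayageCondition x ε) :
    ∃ g : ℂ → ℂ, DifferentiableOn ℂ g (Metric.ball 0 1) ∧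
      (∀ w ∈ Metric.ball (0 : ℂ) 1, ‖g w‖ ≤ 1) ∧ g 0 ≠ 0 ∧
      (∀ i, z i ≠ 0 → g (z i) = 0) ∧ ∀ i, ‖g (x i)‖ ≤ ε i := by
  classical
  obtain ⟨m, hm, hmz⟩ := exists_pos_le_prod_norm hz hB
  obtain ⟨C, hC, hbal⟩ := hbal
  have H : ∀ k : Finset ι × Finset κ, _ := fun k =>
    exists_norm_le_on_finset hz hx hε hmz hC hbal (k.1.filter fun i => z i ≠ 0)
      (fun i hi => (Finset.mem_filter.1 hi).2) k.2
  choose f hf hfb hf0 hfz hfx using H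
  set U : Ultrafilter (Finset ι × Finset κ) := Ultrafilter.of Filter.atTop with hU
  have hUle : (U : Filter (Finset ι × Finset κ)) ≤ Filter.atTop := by
    rw [hU]
    exact Ultrafilter.of_le _
  obtain ⟨g, hg, hlim⟩ := exists_differentiableOn_tendsto U hf hfb
  have h0 : (0 : ℂ) ∈ Metric.ball (0 : ℂ) 1 := by simp
  refine ⟨g, hg, fun w hw => ?_, ?_, fun i hi => ?_, fun i => ?_⟩
  · exact le_of_tendsto (hlim w hw).norm (Filter.Eventually.of_forall fun k => hfb k w hw)
  · have h : Real.exp (-1 - C) * m ≤ ‖g 0‖ :=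
      ge_of_tendsto (hlim 0 h0).norm (Filter.Eventually.of_forall hf0)
    exact norm_pos_iff.1 (lt_of_lt_of_le (by positivity) h)
  · refine tendsto_nhds_unique_of_eventuallyEq (hlim (z i) (by simpa using hz i))
      tendsto_const_nhds ?_
    filter_upwards [hUle (Filter.eventually_ge_atTop (({i}, ∅) : Finset ι × Finset κ))] with k hk
    exact hfz k i (Finset.mem_filter.2 ⟨hk.1 (Finset.mem_singleton_self i), hi⟩)
  · refine le_of_tendsto (hlim (x i) (by simpa using hx i)).norm ?_
    filter_upwards [hUle (Filter.eventually_ge_atTop ((∅, {i}) : Finset ι × Finset κ))] with k hk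
    exact hfx k i (hk.2 (Finset.mem_singleton_self i))

/-! ### The characterization -/

theorem corollary1p4 (Λ : ℕ → ℂ) (hΛ : ∀ n, ‖Λ n‖ < 1)
    (hsep : IsSeparatedSeq Λ) (hnB : ¬ IsBlaschkeSeq Λ)
    (ε : ℕ → ℝ) (hε : ∀ n, 0 < ε n) :
    (∃ f : ℂ → ℂ, MemHInfty f ∧ (∃ z ∈ Metric.ball (0 : ℂ) 1, f z ≠ 0) ∧
        ∀ n, ‖f (Λ n)‖ < ε n) ↔
      ∃ B Γ : Set ℕ, B ∪ Γ = Set.univ ∧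
        IsBlaschkeSeq (fun n : B => Λ n) ∧
        BalayageCondition (fun n : Γ => Λ n) (fun n : Γ => ε n) := by
  constructor
  · rintro ⟨f₀, ⟨hf₀, M, hM⟩, ⟨w, hw, hfw₀⟩, hfε₀⟩
    -- normalize so that the function is bounded by `1`
    set N : ℝ := max M 1
    have hN1 : 1 ≤ N := le_max_right _ _
    have hNC : ‖((N⁻¹ : ℝ) : ℂ)‖ = N⁻¹ := by
      rw [Complex.norm_real, Real.norm_of_nonneg (by positivity)]
    set f : ℂ → ℂ := fun z => ((N⁻¹ : ℝ) : ℂ) * f₀ z with hfdef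
    have hf : DifferentiableOn ℂ f (Metric.ball 0 1) := hf₀.const_mul _
    have hb : ∀ z ∈ Metric.ball (0 : ℂ) 1, ‖f z‖ ≤ 1 := fun z hz => by
      rw [hfdef, norm_mul, hNC, inv_mul_le_iff₀ (by positivity), mul_one]
      exact (hM z hz).trans (le_max_left _ _)
    have hfw : f w ≠ 0 := mul_ne_zero (norm_pos_iff.1 (by rw [hNC]; positivity)) hfw₀
    have hfε : ∀ n, ‖f (Λ n)‖ ≤ ε n := fun n => by
      rw [hfdef, norm_mul, hNC]
      exact (mul_le_of_le_one_left (norm_nonneg _) (inv_le_one_of_one_le₀ hN1)).trans (hfε₀ n).le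
    rw [mem_ball_zero_iff] at hw
    obtain ⟨δ, hδ, hsep⟩ := hsep
    have hδ1 : δ ≤ 1 := (hsep 0 1 (by norm_num)).trans (pseudoHyperbolicDist_lt_one (hΛ 0) (hΛ 1)).le
    set B : Set ℕ := {n | ∃ a : ℂ, ‖a‖ < 1 ∧ f a = 0 ∧ pseudoHyperbolicDist (Λ n) a ≤ δ / 8}
    refine ⟨B, Bᶜ, Set.union_compl_self B, ?_, ?_⟩
    · exact isBlaschkeSeq_of_close_to_zeros hf hb hw hfw (fun n => hΛ n) hδ hδ1
        (fun i j hij => hsep i j (Subtype.coe_injective.ne hij)) fun n => n.2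
    · refine balayageCondition_of_norm_le hf hb hw hfw (fun n => hΛ n) (δ := δ / 8) (by linarith)
        (by linarith) (fun n a ha hfa => ?_) fun n => hfε n
      by_contra! hlt
      exact n.2 ⟨a, ha, hfa, hlt.le⟩
  · rintro ⟨B, Γ, hBΓ, hB, hbal⟩
    obtain ⟨g, hg, hgb, hg0, hgB, hgΓ⟩ := exists_norm_le_of_balayageCondition (fun n : B => hΛ n)
      (fun n : Γ => hΛ n) (fun n : Γ => hε n) hB hbal
    -- the factor `z` takes care of a point of `B` at the origin
    refine ⟨fun z => z * g z / 2, ⟨by fun_prop, 1, fun z hz => ?_⟩, ?_, fun n => ?_⟩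
    · rw [norm_div, norm_mul, Complex.norm_two]
      have h1 := hgb z hz
      have h2 := (mem_ball_zero_iff.1 hz).le
      nlinarith [norm_nonneg z, norm_nonneg (g z)]
    · have h0 : Metric.ball (0 : ℂ) 1 ∈ nhds 0 := Metric.ball_mem_nhds 0 one_pos
      have hne := (hg.differentiableAt h0).continuousAt.eventually_ne hg0
      have hev : ∀ᶠ z in nhdsWithin (0 : ℂ) {0}ᶜ, g z ≠ 0 ∧ z ∈ Metric.ball (0 : ℂ) 1 :=
        nhdsWithin_le_nhds (hne.and h0)
      obtain ⟨z, ⟨hz1, hz2⟩, hz3⟩ := (hev.and self_mem_nhdsWithin).exists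
      exact ⟨z, hz2, div_ne_zero (mul_ne_zero hz3 hz1) two_ne_zero⟩
    · by_cases hn : n ∈ B
      · have : Λ n * g (Λ n) / 2 = 0 := by
          by_cases h : Λ n = 0
          · simp [h]
          · simp [hgB ⟨n, hn⟩ h]
        simpa only [this, norm_zero] using hε n
      · have hnΓ : n ∈ Γ := by
          have : n ∈ B ∪ Γ := hBΓ ▸ Set.mem_univ n
          exact this.resolve_left hn
        have h1 : ‖g (Λ n)‖ ≤ ε n := hgΓ ⟨n, hnΓ⟩
        rw [norm_div, norm_mul, Complex.norm_two]
        have h2 := hΛ n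
        have h3 := hε n
        nlinarith [norm_nonneg (Λ n), norm_nonneg (g (Λ n))]
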